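/- Let $M$ be a smooth manifold and let $(A,[\cdot,\cdot],\rho)$ be a Lie algebroid over $M$. Let $d$ be the differential of $A$ on $\Gamma(\bigwedge^\bullet A^*)$, given by the Koszul formula. Let $\pi\in\Gamma(\bigwedge^2A)$ be a Poisson bivector, i.e. $[\pi,\pi]_{SN}=0$ for the Schouten–Nijenhuis bracket, and let $\omega\in\Gamma(\bigwedge^2A^*)$ satisfy $d\omega=0$. Put $\pi^\sharp(\alpha)=\pi(\alpha,\cdot)$, $\omega^\flat(X)=\omega(X,\cdot)$, $N=\pi^\sharp\circ\omega^\flat$, ${}^tN\alpha=\alpha\circ N$, $\omega_N=\omega(N\cdot,\cdot)$ (which is a $2$-form) and $\psi=d\omega_N$. Let $[X,Y]_N=[NX,Y]+[X,NY]-N[X,Y]$ and $\rho_N=\rho\circ N$, and let $d_N$ be given by the Koszul formula with $[\cdot,\cdot]_N$ and $\rho_N$ in place of $[\cdot,\cdot]$ and $\rho$. Let $[\alpha,\beta]_\pi=\mathcal L_{\pi^\sharp\alpha}\beta-\mathcal L_{\pi^\sharp\beta}\alpha-d(\pi(\alpha,\beta))$, and let $([\cdot,\cdot]_N)_\pi$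 be given by the same formula with the Lie derivative and differential defined by $[\cdot,\cdot]_N$ and $\rho_N$. Then $(\pi,N,\psi)$ is a Poisson quasi-Nijenhuis structure (without background) on $A$, that is: 1. $\pi$ is a Poisson bivector, and $N\circ\pi^\sharp=\pi^\sharp\circ{}^tN$; 2. $C_{\pi,N}:=([\cdot,\cdot]_N)_\pi-([\cdot,\cdot]_\pi)_{{}^tN}=0$, where $([\alpha,\beta]_\pi)_{{}^tN}=[{}^tN\alpha,\beta]_\pi+[\alpha,{}^tN\beta]_\pi-{}^tN[\alpha,\beta]_\pi$; 3. for all $X,Y\in\Gamma(A)$, $$[NX,NY]-N\big([NX,Y]+[X,NY]-N[X,Y]\big)=\pi^\sharp(i_{X\wedge Y}\psi),$$ where $i_{X\wedge Y}=i_X\circ i_Y$, i.e. $(i_{X\wedge Y}\psi)(Z)=\psi(Y,X,Z)$; 4. $d\psi=0$ and $d_N\psi=0$. -/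

import Mathlib

open scoped Manifold ContDiff

noncomputable section

/-! ### Alternating tensors over a commutative ring of functions

Below, `R` plays the role of `C^∞(M)` and `L` that of the module `Γ(A)` of smooth sections of a
vector bundle `A → M`. Tensor fields are represented by `C^∞(M)`-multilinear maps on sections. -/

section Tensors

variable {R L : Type*} [CommRing R] [AddCommGroup L] [Module R L]

/-- Contraction of an alternating bilinear map with its first argument: `B♭ x = B(x, ·)`. -/
def flat (B : L [⋀^Fin 2]→ₗ[R] R) : L →ₗ[R] Module.Dual R L :=
  LinearMap.mk₂ R (fun x y => B ![x, y])
    (fun x x' y => B.map_vecCons_add ![y] x x')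
    (fun c x y => B.map_vecCons_smul ![y] c x)
    (fun x y y' => by
      have e : ∀ z, Function.update ![x, y] 1 z = ![x, z] := fun z => by
        funext i; fin_cases i <;> rfl
      simpa only [e] using B.map_update_add ![x, y] 1 y y')
    (fun c x y => by
      have e : ∀ z, Function.update ![x, y] 1 z = ![x, z] := fun z => by
        funext i; fin_cases i <;> rfl
      simpa only [e] using B.map_update_smul ![x, y] 1 c y)

@[simp] theorem flat_apply (B : L [⋀^Fin 2]→ₗ[R] R) (x y : L) : flat B x y = B ![x, y] := rfl

theorem alt_self (B : L [⋀^Fin 2]→ₗ[R] R) (x : L) : B ![x, x] = 0 :=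
  B.map_eq_zero_of_eq ![x, x] (i := 0) (j := 1) rfl (by decide)

theorem alt_swap (B : L [⋀^Fin 2]→ₗ[R] R) (x y : L) : B ![y, x] = -B ![x, y] := by
  have h := alt_self B (x + y)
  have h' : flat B (x + y) (x + y) = 0 := h
  simp only [map_add, LinearMap.add_apply, flat_apply, alt_self, zero_add, add_zero] at h'
  exact eq_neg_of_add_eq_zero_left h'

/-- The alternating map given by an alternating bilinear form. -/
def mkAlt2 (B : L →ₗ[R] Module.Dual R L) (h : ∀ x, B x x = 0) : L [⋀^Fin 2]→ₗ[R] R where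
  toFun v := B (v 0) (v 1)
  map_update_add' v i x y := by
    fin_cases i <;> simp
  map_update_smul' v i c x := by
    fin_cases i <;> simp
  map_eq_zero_of_eq' v i j hv hij := by
    fin_cases i <;> fin_cases j <;> simp_all

@[simp] theorem mkAlt2_apply (B : L →ₗ[R] Module.Dual R L) (h : ∀ x, B x x = 0) (x y : L) :
    mkAlt2 B h ![x, y] = B x y := rfl

/-- The alternating map given by a skew-symmetric trilinear function. -/
def mkAlt3 [Algebra ℝ R] (f : L → L → L → R) (hadd : ∀ x x' y z, f (x + x') y z = f x y z + f x' y z)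
    (hsmul : ∀ (c : R) x y z, f (c • x) y z = c * f x y z)
    (h12 : ∀ x y z, f y x z = -f x y z) (h23 : ∀ x y z, f x z y = -f x y z) :
    L [⋀^Fin 3]→ₗ[R] R where
  toFun v := f (v 0) (v 1) (v 2)
  map_update_add' {inst} v i x y := by
    obtain rfl := Subsingleton.elim inst (instDecidableEqFin 3)
    have hadd2 : ∀ x y y' z, f x (y + y') z = f x y z + f x y' z := fun x y y' z => by
      rw [h12, hadd, h12 x y, h12 x y']; ring
    have hadd3 : ∀ x y z z', f x y (z + z') = f x y z + f x y z' := fun x y z z' => by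
      rw [h23, hadd2, h23 x y z, h23 x y z']; ring
    fin_cases i <;> simp [hadd, hadd2, hadd3]
  map_update_smul' {inst} v i c x := by
    obtain rfl := Subsingleton.elim inst (instDecidableEqFin 3)
    have hsmul2 : ∀ (c : R) x y z, f x (c • y) z = c * f x y z := fun c x y z => by
      rw [h12, hsmul, h12 x y]; ring
    have hsmul3 : ∀ (c : R) x y z, f x y (c • z) = c * f x y z := fun c x y z => by
      rw [h23, hsmul2, h23 x y z]; ring
    fin_cases i <;> simp [hsmul, hsmul2, hsmul3]
  map_eq_zero_of_eq' v i j hv hij := by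
    have half : ∀ a : R, a = -a → a = 0 := fun a ha => by
      have h2 : (2 : ℝ) • a = 0 := by rw [two_smul]; nth_rewrite 1 [ha]; simp
      have h3 := congrArg (fun t => (2 : ℝ)⁻¹ • t) h2
      simpa [smul_smul] using h3
    have e12 : ∀ x z, f x x z = 0 := fun x z => half _ (h12 x x z)
    have e23 : ∀ x z, f x z z = 0 := fun x z => half _ (h23 x z z)
    have e13 : ∀ x z, f x z x = 0 := fun x z => by rw [h23, e12, neg_zero]
    fin_cases i <;> fin_cases j <;>
      first
      | exact absurd rfl hij
      | (simp only [Fin.zero_eta, Fin.mk_one, Fin.reduceFinMk] at hv; simp [hv, e12, e23, e13])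

@[simp] theorem mkAlt3_apply [Algebra ℝ R] (f : L → L → L → R) (hadd hsmul h12 h23) (x y z : L) :
    mkAlt3 (R := R) f hadd hsmul h12 h23 ![x, y, z] = f x y z := rfl

/-- The contraction of a `3`-form with `x ∧ y`, in the convention `i_{x ∧ y} = i_x ∘ i_y`, that is
`(i_{x ∧ y} ψ)(z) = ψ(y, x, z)`. -/
def contract₂ (ψ : L [⋀^Fin 3]→ₗ[R] R) (x y : L) : Module.Dual R L :=
  flat (ψ.curryLeft y) x

@[simp] theorem contract₂_apply (ψ : L [⋀^Fin 3]→ₗ[R] R) (x y z : L) :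
    contract₂ ψ x y z = ψ ![y, x, z] := rfl

/-- The transpose `ᵗN α = α ∘ N`. -/
def transp (N : Module.End R L) : Module.End R (Module.Dual R L) := Module.Dual.transpose N

@[simp] theorem transp_apply (N : Module.End R L) (α : Module.Dual R L) (x : L) :
    transp N α x = α (N x) := rfl

/-- The bivector `x ∧ y`, as an alternating map: `(x ∧ y)(α, β) = α(x) β(y) - α(y) β(x)`. -/
def wedge (x y : L) : Module.Dual R L [⋀^Fin 2]→ₗ[R] R :=
  mkAlt2 (LinearMap.mk₂ R (fun α β => α x * β y - α y * β x)
    (fun _ _ _ => by simp only [LinearMap.add_apply]; ring)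
    (fun _ _ _ => by simp only [LinearMap.smul_apply, smul_eq_mul]; ring)
    (fun _ _ _ => by simp only [LinearMap.add_apply]; ring)
    (fun _ _ _ => by simp only [LinearMap.smul_apply, smul_eq_mul]; ring))
    (fun α => by simp only [LinearMap.mk₂_apply]; ring)

/-- The trivector `x ∧ y ∧ z` evaluated on three `1`-forms. -/
def wedge3 (x y z : L) (α β γ : Module.Dual R L) : R :=
  α x * (β y * γ z - β z * γ y) - α y * (β x * γ z - β z * γ x) + α z * (β x * γ y - β y * γ x)

theorem wedge_apply (x y : L) (α β : Module.Dual R L) :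
    wedge x y ![α, β] = α x * β y - α y * β x := rfl

variable [Module.IsReflexive R L]

/-- For a bivector `π`, i.e. an alternating bilinear map on the dual, `π♯ α = π(α, ·)`, as an
element of the double dual `L** = L`. -/
def sharp (π : Module.Dual R L [⋀^Fin 2]→ₗ[R] R) : Module.Dual R L →ₗ[R] L :=
  (Module.evalEquiv R L).symm.toLinearMap ∘ₗ flat π

@[simp] theorem apply_sharp (π : Module.Dual R L [⋀^Fin 2]→ₗ[R] R) (α β : Module.Dual R L) :
    β (sharp π α) = π ![α, β] :=
  Module.apply_evalEquiv_symm_apply R L β (flat π α)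

theorem sharp_wedge (x y : L) (α : Module.Dual R L) :
    sharp (wedge x y) α = α x • y - α y • x := by
  apply (Module.evalEquiv R L).injective
  ext β
  simp [wedge_apply]

/-- The endomorphism `N = π♯ ∘ Ω♭`. -/
def recursion (π : Module.Dual R L [⋀^Fin 2]→ₗ[R] R) (Ω : L [⋀^Fin 2]→ₗ[R] R) :
    Module.End R L :=
  sharp π ∘ₗ flat Ω

/-- The `2`-form `Ω_N = Ω(N ·, ·)` for `N = π♯ ∘ Ω♭`. -/
def omegaN (π : Module.Dual R L [⋀^Fin 2]→ₗ[R] R) (Ω : L [⋀^Fin 2]→ₗ[R] R) :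
    L [⋀^Fin 2]→ₗ[R] R :=
  mkAlt2 (flat Ω ∘ₗ recursion π Ω) fun x => by
    have h : Ω ![x, recursion π Ω x] = 0 := by
      rw [← flat_apply]
      simp only [recursion, LinearMap.comp_apply, apply_sharp, alt_self]
    simp only [LinearMap.comp_apply, flat_apply]
    rw [alt_swap, h, neg_zero]

theorem omegaN_apply (π : Module.Dual R L [⋀^Fin 2]→ₗ[R] R) (Ω : L [⋀^Fin 2]→ₗ[R] R) (x y : L) :
    omegaN π Ω ![x, y] = Ω ![recursion π Ω x, y] := rfl

end Tensors

/-! ### Cartan calculus of a bracket with anchor -/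

/-- A skew-symmetric bracket on `L` with an anchor, satisfying the Leibniz rule. No Jacobi identity
is required: the bracket deformed by an arbitrary endomorphism is of this kind. -/
structure SkewAlgebroid (R L : Type*) [CommRing R] [Algebra ℝ R] [AddCommGroup L] [Module R L] where
  anchor : L →ₗ[R] Derivation ℝ R R
  bracket : L → L → L
  bracket_add : ∀ x y z, bracket x (y + z) = bracket x y + bracket x z
  bracket_skew : ∀ x y, bracket y x = -bracket x y
  leibniz : ∀ (x : L) (f : R) (y : L), bracket x (f • y) = f • bracket x y + anchor x f • y

namespace SkewAlgebroid

variable {R L : Type*} [CommRing R] [Algebra ℝ R] [AddCommGroup L] [Module R L]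
variable (S : SkewAlgebroid R L)

theorem add_bracket (x y z : L) : S.bracket (x + y) z = S.bracket x z + S.bracket y z := by
  rw [S.bracket_skew z, S.bracket_add, S.bracket_skew x z, S.bracket_skew y z]; abel

theorem smul_bracket (f : R) (x y : L) :
    S.bracket (f • x) y = f • S.bracket x y - S.anchor y f • x := by
  rw [S.bracket_skew y, S.leibniz, S.bracket_skew x y]; module

theorem bracket_neg (x y : L) : S.bracket x (-y) = -S.bracket x y := by
  have h := S.leibniz x (-1) y
  simpa using h

theorem neg_bracket (x y : L) : S.bracket (-x) y = -S.bracket x y := by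
  rw [S.bracket_skew y, S.bracket_neg, S.bracket_skew x y, neg_neg]

/-- The differential of a function: `(df)(x) = ρ(x) f`. -/
def dFun (f : R) : Module.Dual R L where
  toFun x := S.anchor x f
  map_add' x y := by simp
  map_smul' c x := by simp

/-- The Lie derivative of a `1`-form: `(ℒ_x β)(y) = ρ(x)(β(y)) - β([x, y])`. -/
def lieForm (x : L) (β : Module.Dual R L) : Module.Dual R L where
  toFun y := S.anchor x (β y) - β (S.bracket x y)
  map_add' y z := by simp only [map_add, S.bracket_add]; ring
  map_smul' c y := by
    simp only [map_smul, S.leibniz, map_add, smul_eq_mul, Derivation.leibniz, RingHom.id_apply]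
    ring

/-- The exterior differential of a `2`-form, by the Koszul formula. -/
def dTwo (Ω : L [⋀^Fin 2]→ₗ[R] R) : L [⋀^Fin 3]→ₗ[R] R :=
  mkAlt3 (fun x y z =>
      S.anchor x (Ω ![y, z]) - S.anchor y (Ω ![x, z]) + S.anchor z (Ω ![x, y])
        - Ω ![S.bracket x y, z] + Ω ![S.bracket x z, y] - Ω ![S.bracket y z, x])
    (fun x x' y z => by
      simp only [← flat_apply, map_add, S.add_bracket, LinearMap.add_apply,
        Derivation.add_apply]
      ring)
    (fun c x y z => by
      simp only [← flat_apply]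
      simp only [map_smul, S.smul_bracket, LinearMap.smul_apply, map_sub,
        LinearMap.sub_apply, smul_eq_mul, Derivation.leibniz, Derivation.smul_apply]
      ring)
    (fun x y z => by
      rw [S.bracket_skew x y, alt_swap Ω x y]
      simp only [← flat_apply, map_neg, LinearMap.neg_apply]
      ring)
    (fun x y z => by
      rw [S.bracket_skew y z, alt_swap Ω y z]
      simp only [← flat_apply, map_neg, LinearMap.neg_apply]
      ring)

/-- The exterior differential of a `3`-form, by the Koszul formula. -/
def dThree (ψ : L [⋀^Fin 3]→ₗ[R] R) (x y z w : L) : R :=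
  S.anchor x (ψ ![y, z, w]) - S.anchor y (ψ ![x, z, w])
    + S.anchor z (ψ ![x, y, w]) - S.anchor w (ψ ![x, y, z])
    - ψ ![S.bracket x y, z, w] + ψ ![S.bracket x z, y, w] - ψ ![S.bracket x w, y, z]
    - ψ ![S.bracket y z, x, w] + ψ ![S.bracket y w, x, z] - ψ ![S.bracket z w, x, y]

/-- The structure deformed by an endomorphism `N`:
`[x, y]_N = [Nx, y] + [x, Ny] - N[x, y]` with anchor `ρ ∘ N`. -/
def deform (N : Module.End R L) : SkewAlgebroid R L where
  anchor := S.anchor ∘ₗ N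
  bracket x y := S.bracket (N x) y + S.bracket x (N y) - N (S.bracket x y)
  bracket_add x y z := by simp only [map_add, S.bracket_add]; abel
  bracket_skew x y := by
    rw [S.bracket_skew x y, S.bracket_skew x (N y), S.bracket_skew (N x) y, map_neg]; abel
  leibniz x f y := by
    simp only [map_smul, S.leibniz, map_add, LinearMap.comp_apply]
    module

/-- The Nijenhuis torsion `T_N(x, y) = [Nx, Ny] - N([Nx, y] + [x, Ny] - N[x, y])`. -/
def torsion (N : Module.End R L) (x y : L) : L :=
  S.bracket (N x) (N y) - N (S.bracket (N x) y + S.bracket x (N y) - N (S.bracket x y))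

variable [Module.IsReflexive R L]

/-- The Schouten-Nijenhuis bracket of two bivectors, evaluated on three `1`-forms. It is the
extension of the bracket of sections to bivectors by the graded Leibniz rule, see
`schouten_wedge`. -/
def schouten (P Q : Module.Dual R L [⋀^Fin 2]→ₗ[R] R) (α β γ : Module.Dual R L) : R :=
  (α (S.bracket (sharp P β) (sharp Q γ)) + α (S.bracket (sharp Q β) (sharp P γ))
      - S.anchor (sharp P α) (Q ![β, γ]) - S.anchor (sharp Q α) (P ![β, γ]))
  + (β (S.bracket (sharp P γ) (sharp Q α)) + β (S.bracket (sharp Q γ) (sharp P α))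
      - S.anchor (sharp P β) (Q ![γ, α]) - S.anchor (sharp Q β) (P ![γ, α]))
  + (γ (S.bracket (sharp P α) (sharp Q β)) + γ (S.bracket (sharp Q α) (sharp P β))
      - S.anchor (sharp P γ) (Q ![α, β]) - S.anchor (sharp Q γ) (P ![α, β]))

/-- On decomposable bivectors `schouten` is given by the graded Leibniz rule:
`[x ∧ y, z ∧ w] = [x, z] ∧ y ∧ w - [x, w] ∧ y ∧ z - [y, z] ∧ x ∧ w + [y, w] ∧ x ∧ z`. -/
theorem schouten_wedge (x y z w : L) (α β γ : Module.Dual R L) :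
    S.schouten (wedge x y) (wedge z w) α β γ =
      wedge3 (S.bracket x z) y w α β γ - wedge3 (S.bracket x w) y z α β γ
        - wedge3 (S.bracket y z) x w α β γ + wedge3 (S.bracket y w) x z α β γ := by
  have sub_b : ∀ a b c, S.bracket (a - b) c = S.bracket a c - S.bracket b c := fun a b c => by
    rw [sub_eq_add_neg, S.add_bracket, S.neg_bracket, sub_eq_add_neg]
  have b_sub : ∀ a b c, S.bracket a (b - c) = S.bracket a b - S.bracket a c := fun a b c => by
    rw [sub_eq_add_neg, S.bracket_add, S.bracket_neg, sub_eq_add_neg]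
  simp only [schouten, sharp_wedge, wedge_apply, wedge3, sub_b, b_sub, S.smul_bracket, S.leibniz,
    map_sub, map_add, map_smul, smul_eq_mul, Derivation.leibniz,
    Derivation.sub_apply, Derivation.smul_apply, S.bracket_skew x z, S.bracket_skew x w,
    S.bracket_skew y z, S.bracket_skew y w, map_neg, smul_add]
  ring

/-- `π` is a Poisson bivector: `[π, π] = 0` for the Schouten-Nijenhuis bracket. -/
def IsPoisson (π : Module.Dual R L [⋀^Fin 2]→ₗ[R] R) : Prop :=
  ∀ α β γ, S.schouten π π α β γ = 0

/-- The bracket of `1`-forms defined by a bivector: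
`[α, β]_π = ℒ_{π♯α} β - ℒ_{π♯β} α - d(π(α, β))`. -/
def formBracket (π : Module.Dual R L [⋀^Fin 2]→ₗ[R] R) (α β : Module.Dual R L) :
    Module.Dual R L :=
  S.lieForm (sharp π α) β - S.lieForm (sharp π β) α - S.dFun (π ![α, β])

/-- The concomitant `C_{π,N} = ([·,·]_N)_π - ([·,·]_π)_{ᵗN}`: the bracket of `1`-forms defined by
`π` from the `N`-deformed structure, minus the `ᵗN`-deformation of `[·,·]_π`. -/
def concomitant (π : Module.Dual R L [⋀^Fin 2]→ₗ[R] R) (N : Module.End R L)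
    (α β : Module.Dual R L) : Module.Dual R L :=
  (S.deform N).formBracket π α β
    - (S.formBracket π (transp N α) β + S.formBracket π α (transp N β)
        - transp N (S.formBracket π α β))

/-- `(π, N, ψ)` is a Poisson quasi-Nijenhuis structure (without background). The differential
`d_N` is the one of the deformed structure `S.deform N`. -/
structure IsPoissonQuasiNijenhuis (π : Module.Dual R L [⋀^Fin 2]→ₗ[R] R) (N : Module.End R L)
    (ψ : L [⋀^Fin 3]→ₗ[R] R) : Prop where
  poisson : S.IsPoisson π
  comm : N ∘ₗ sharp π = sharp π ∘ₗ transp N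
  concomitant_eq_zero : ∀ α β, S.concomitant π N α β = 0
  torsion_eq : ∀ x y, S.torsion N x y = sharp π (contract₂ ψ x y)
  closed : ∀ x y z w, S.dThree ψ x y z w = 0
  closed_deform : ∀ x y z w, (S.deform N).dThree ψ x y z w = 0

end SkewAlgebroid

/-! ### Sections of a smooth vector bundle -/

section Sections

variable {E : Type*} [NormedAddCommGroup E] [NormedSpace ℝ E]
  {M : Type*} [TopologicalSpace M] [ChartedSpace E M]
  {F : Type*} [NormedAddCommGroup F] [NormedSpace ℝ F]
  {A : M → Type*} [∀ x, AddCommGroup (A x)] [∀ x, Module ℝ (A x)] [∀ x, TopologicalSpace (A x)]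
  [TopologicalSpace (Bundle.TotalSpace F A)] [FiberBundle F A] [VectorBundle ℝ F A]

instance sectionSMul : SMul C^∞⟮𝓘(ℝ, E), M; ℝ⟯ Cₛ^∞⟮𝓘(ℝ, E); F, A⟯ where
  smul f X := ⟨fun x => f x • X x, f.contMDiff.smul_section X.contMDiff⟩

theorem section_smul_apply (f : C^∞⟮𝓘(ℝ, E), M; ℝ⟯) (X : Cₛ^∞⟮𝓘(ℝ, E); F, A⟯) (x : M) :
    (f • X) x = f x • X x := rfl

/-- `Γ(A)` is a module over `C^∞(M)`, pointwise. -/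
instance sectionModule : Module C^∞⟮𝓘(ℝ, E), M; ℝ⟯ Cₛ^∞⟮𝓘(ℝ, E); F, A⟯ where
  one_smul X := by ext x; exact one_smul ℝ (X x)
  mul_smul f g X := by ext x; exact mul_smul (f x) (g x) (X x)
  smul_zero f := by ext x; exact smul_zero (f x)
  smul_add f X Y := by ext x; exact smul_add (f x) (X x) (Y x)
  add_smul f g X := by ext x; exact add_smul (f x) (g x) (X x)
  zero_smul X := by ext x; exact zero_smul ℝ (X x)

variable [FiniteDimensional ℝ E] [IsManifold 𝓘(ℝ, E) ∞ M] [T2Space M]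
  [FiniteDimensional ℝ F] [ContMDiffVectorBundle ∞ F A 𝓘(ℝ, E)]

/-- Near any point, sections are combinations of finitely many global sections `s i`, with
coefficients given by global `1`-forms `a i`. -/
theorem exists_local_dual_basis (x₀ : M) :
    ∃ (n : ℕ) (g : C^∞⟮𝓘(ℝ, E), M; ℝ⟯) (s : Fin n → Cₛ^∞⟮𝓘(ℝ, E); F, A⟯)
      (a : Fin n → Module.Dual C^∞⟮𝓘(ℝ, E), M; ℝ⟯ Cₛ^∞⟮𝓘(ℝ, E); F, A⟯),
      g x₀ = 1 ∧ ∀ X, g • X = ∑ i, a i X • s i := by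
  have : ContMDiffVectorBundle 1 F A 𝓘(ℝ, E) := ContMDiffVectorBundle.of_le (n := ∞) (by simp)
  let e := trivializationAt F A x₀
  have hx₀ : x₀ ∈ e.baseSet := FiberBundle.mem_baseSet_trivializationAt' x₀
  let b := Module.finBasis ℝ F
  obtain ⟨χ, hχ, -⟩ := (SmoothBumpFunction.nhds_basis_support (I := 𝓘(ℝ, E))
    (e.open_baseSet.mem_nhds hx₀)).mem_iff.1 (e.open_baseSet.mem_nhds hx₀)
  let s : Fin (Module.finrank ℝ F) → Cₛ^∞⟮𝓘(ℝ, E); F, A⟯ := fun i =>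
    ⟨(χ : M → ℝ) • e.localFrame b i,
      ContMDiffOn.smul_section_of_tsupport χ.contMDiff.contMDiffOn e.open_baseSet hχ
        (e.contMDiffOn_localFrame_baseSet ∞ b i)⟩
  have hcoef : ∀ (X : Cₛ^∞⟮𝓘(ℝ, E); F, A⟯) i, ContMDiff 𝓘(ℝ, E) 𝓘(ℝ, ℝ) ∞
      (fun x => χ x * e.localFrameCoeff 𝓘(ℝ, E) b i x (X x)) := fun X i => by
    refine contMDiff_of_tsupport fun x hx => ?_
    have hx' : x ∈ e.baseSet := hχ (tsupport_smul_subset_left (χ : M → ℝ) _ hx)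
    exact χ.contMDiff.contMDiffAt.mul
      (contMDiffAt_localFrameCoeff (e := e) b hx' X.contMDiff.contMDiffAt i)
  let a : Fin (Module.finrank ℝ F) →
      Module.Dual C^∞⟮𝓘(ℝ, E), M; ℝ⟯ Cₛ^∞⟮𝓘(ℝ, E); F, A⟯ := fun i =>
    { toFun := fun X => ⟨_, hcoef X i⟩
      map_add' := fun X Y => by
        ext x
        change χ x * e.localFrameCoeff 𝓘(ℝ, E) b i x (X x + Y x) = χ x * _ + χ x * _
        rw [map_add, mul_add]
      map_smul' := fun f X => by
        ext x
        change χ x * e.localFrameCoeff 𝓘(ℝ, E) b i x (f x • X x) = f x * (χ x * _)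
        rw [map_smul, smul_eq_mul]; ring }
  refine ⟨_, ⟨fun x => χ x * χ x, χ.contMDiff.mul χ.contMDiff⟩, s, a, ?_, fun X => ?_⟩
  · change χ x₀ * χ x₀ = 1
    rw [χ.eq_one, one_mul]
  · ext x
    have hsum : (∑ i, a i X • s i) x = ∑ i, (a i X • s i) x := by
      have := map_sum (ContMDiffSection.coeAddHom 𝓘(ℝ, E) F ∞ A) (fun i => a i X • s i) Finset.univ
      have h2 := congrFun this x
      rw [Finset.sum_apply] at h2
      exact h2
    rw [hsum]
    change (χ x * χ x) • X x =
      ∑ i, (χ x * e.localFrameCoeff 𝓘(ℝ, E) b i x (X x)) • (χ x • e.localFrame b i x)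
    by_cases hx : x ∈ e.baseSet
    · have h := e.eq_sum_localFrameCoeff_smul (I := 𝓘(ℝ, E)) (b := b) (s := X) hx
      conv_lhs => rw [h]
      rw [Finset.smul_sum]
      refine Finset.sum_congr rfl fun i _ => ?_
      rw [smul_smul, smul_smul]; congr 1; ring
    · have h0 : χ x = 0 := image_eq_zero_of_notMem_tsupport fun h => hx (hχ h)
      simp [h0]

/-- `Γ(A)` is a reflexive `C^∞(M)`-module. -/
instance sectionReflexive :
    Module.IsReflexive C^∞⟮𝓘(ℝ, E), M; ℝ⟯ Cₛ^∞⟮𝓘(ℝ, E); F, A⟯ where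
  bijective_dual_eval' := by
    have sep : ∀ X Y : Cₛ^∞⟮𝓘(ℝ, E); F, A⟯,
        (∀ β : Module.Dual C^∞⟮𝓘(ℝ, E), M; ℝ⟯ Cₛ^∞⟮𝓘(ℝ, E); F, A⟯, β X = β Y) → X = Y := by
      intro X Y h
      ext x
      obtain ⟨n, g, s, a, hg, hX⟩ := exists_local_dual_basis (E := E) (F := F) (A := A) x
      have h1 : g • X = g • Y := by rw [hX, hX]; simp only [h]
      have h2 : (g • X) x = (g • Y) x := by rw [h1]
      simpa [section_smul_apply, hg] using h2
    refine ⟨fun X Y h => sep X Y fun β => LinearMap.congr_fun h β, fun φ => ?_⟩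
    choose n g s a hg hX using exists_local_dual_basis (E := E) (M := M) (F := F) (A := A)
    let Y : M → Cₛ^∞⟮𝓘(ℝ, E); F, A⟯ := fun x => ∑ i, φ (a x i) • s x i
    have hY : ∀ x β, β (Y x) = g x * φ β := by
      intro x β
      have h1 : ∑ i, β (s x i) • a x i = g x • β := by
        ext X : 1
        have h2 := congrArg β (hX x X)
        simp only [map_smul, map_sum, smul_eq_mul] at h2
        simp only [LinearMap.sum_apply, LinearMap.smul_apply, smul_eq_mul]
        rw [h2]
        exact Finset.sum_congr rfl fun i _ => mul_comm _ _
      have h3 := congrArg φ h1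
      simp only [map_smul, map_sum, smul_eq_mul] at h3
      simp only [Y, map_smul, map_sum, smul_eq_mul]
      rw [← h3]
      exact Finset.sum_congr rfl fun i _ => mul_comm _ _
    have hYY : ∀ x y, g x • Y y = g y • Y x := fun x y => sep _ _ fun β => by
      rw [map_smul, map_smul, hY, hY, smul_eq_mul, smul_eq_mul]; ring
    have key : ∀ x y, g x y • (Y y) y = Y x y := fun x y => by
      have h : (g x • Y y) y = (g y • Y x) y := by rw [hYY]
      simpa [section_smul_apply, hg] using h
    let Z : Cₛ^∞⟮𝓘(ℝ, E); F, A⟯ := ⟨fun x => Y x x, fun x => by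
      have hne : ∀ᶠ y in nhds x, g x y ≠ 0 :=
        (g x).contMDiff.continuous.continuousAt.eventually_ne (by rw [hg]; exact one_ne_zero)
      have hsm := ContMDiffAt.smul_section
        (((g x).contMDiff.contMDiffAt (x := x)).inv₀ (by rw [hg]; exact one_ne_zero))
        ((Y x).contMDiff.contMDiffAt (x := x))
      refine hsm.congr_of_eventuallyEq ?_
      filter_upwards [hne] with y hy
      have : Y y y = (g x y)⁻¹ • Y x y := by
        rw [← key x y, smul_smul, inv_mul_cancel₀ hy, one_smul]
      simp [this]⟩
    have hZ : ∀ x, g x • Z = Y x := fun x => by ext y; exact key x y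
    refine ⟨Z, ?_⟩
    ext β x
    have h1 : g x * β Z = g x * φ β := by rw [← hY, ← hZ, map_smul, smul_eq_mul]
    have h2 : g x x * β Z x = g x x * φ β x := congrArg (fun f : C^∞⟮𝓘(ℝ, E), M; ℝ⟯ => f x) h1
    simpa [hg] using h2

end Sections

/-! ### Lie algebroids -/

/-- A Lie algebroid structure on a smooth vector bundle `A → M`: an anchor `ρ : A → TM`, which is a
smooth morphism of vector bundles over the identity, and a real Lie bracket on `Γ(A)` with
`[X, fY] = f[X, Y] + (ρ(X)f) Y`. -/
structure LieAlgebroid (E : Type*) [NormedAddCommGroup E] [NormedSpace ℝ E]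
    {M : Type*} [TopologicalSpace M] [ChartedSpace E M] [IsManifold 𝓘(ℝ, E) ∞ M]
    (F : Type*) [NormedAddCommGroup F] [NormedSpace ℝ F]
    (A : M → Type*) [∀ x, AddCommGroup (A x)] [∀ x, Module ℝ (A x)] [∀ x, TopologicalSpace (A x)]
    [TopologicalSpace (Bundle.TotalSpace F A)] [FiberBundle F A] [VectorBundle ℝ F A] where
  anchor : ∀ x : M, A x →ₗ[ℝ] TangentSpace 𝓘(ℝ, E) x
  contMDiff_anchor : ContMDiff (𝓘(ℝ, E).prod 𝓘(ℝ, F)) 𝓘(ℝ, E).tangent ∞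
    (fun p : Bundle.TotalSpace F A => (⟨p.1, anchor p.1 p.2⟩ : TangentBundle 𝓘(ℝ, E) M))
  bracket : Cₛ^∞⟮𝓘(ℝ, E); F, A⟯ →ₗ[ℝ] Cₛ^∞⟮𝓘(ℝ, E); F, A⟯ →ₗ[ℝ] Cₛ^∞⟮𝓘(ℝ, E); F, A⟯
  bracket_self : ∀ X, bracket X X = 0
  jacobi : ∀ X Y Z,
    bracket X (bracket Y Z) + bracket Y (bracket Z X) + bracket Z (bracket X Y) = 0
  leibniz : ∀ (X Y : Cₛ^∞⟮𝓘(ℝ, E); F, A⟯) (f : C^∞⟮𝓘(ℝ, E), M; ℝ⟯) (x : M),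
    bracket X (f • Y) x = f x • bracket X Y x + mvfderiv 𝓘(ℝ, E) f x (anchor x (X x)) • Y x

namespace LieAlgebroid

variable {E : Type*} [NormedAddCommGroup E] [NormedSpace ℝ E]
  {M : Type*} [TopologicalSpace M] [ChartedSpace E M] [IsManifold 𝓘(ℝ, E) ∞ M]
  {F : Type*} [NormedAddCommGroup F] [NormedSpace ℝ F]
  {A : M → Type*} [∀ x, AddCommGroup (A x)] [∀ x, Module ℝ (A x)] [∀ x, TopologicalSpace (A x)]
  [TopologicalSpace (Bundle.TotalSpace F A)] [FiberBundle F A] [VectorBundle ℝ F A]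

theorem contMDiff_anchor_apply (𝒜 : LieAlgebroid E F A) (X : Cₛ^∞⟮𝓘(ℝ, E); F, A⟯)
    (f : C^∞⟮𝓘(ℝ, E), M; ℝ⟯) :
    ContMDiff 𝓘(ℝ, E) 𝓘(ℝ, ℝ) ∞
      (fun x => mvfderiv 𝓘(ℝ, E) f x (𝒜.anchor x (X x))) := by
  have h1 : ContMDiff 𝓘(ℝ, E) 𝓘(ℝ, E).tangent ∞
      (fun x => (⟨x, 𝒜.anchor x (X x)⟩ : TangentBundle 𝓘(ℝ, E) M)) :=
    𝒜.contMDiff_anchor.comp X.contMDiff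
  have h2 : ContMDiff 𝓘(ℝ, E).tangent 𝓘(ℝ, ℝ).tangent ∞ (tangentMap 𝓘(ℝ, E) 𝓘(ℝ, ℝ) f) :=
    f.contMDiff.contMDiff_tangentMap (by simp)
  exact (contMDiff_snd_tangentBundle_modelSpace ℝ 𝓘(ℝ, ℝ)).comp (h2.comp h1)

/-- The anchor as a map from sections to derivations: `f ↦ ρ(X) f`. -/
def anchorDer (𝒜 : LieAlgebroid E F A) : Cₛ^∞⟮𝓘(ℝ, E); F, A⟯ →ₗ[C^∞⟮𝓘(ℝ, E), M; ℝ⟯]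
    Derivation ℝ C^∞⟮𝓘(ℝ, E), M; ℝ⟯ C^∞⟮𝓘(ℝ, E), M; ℝ⟯ where
  toFun X := Derivation.mk'
    { toFun := fun f => ⟨_, 𝒜.contMDiff_anchor_apply X f⟩
      map_add' := fun f g => by
        ext x
        have hf := f.contMDiff.mdifferentiableAt (x := x) (by simp)
        have hg := g.contMDiff.mdifferentiableAt (x := x) (by simp)
        exact congrArg (fun T : TangentSpace 𝓘(ℝ, E) x →L[ℝ] ℝ => T (𝒜.anchor x (X x)))
          (mvfderiv_add hf hg)
      map_smul' := fun c f => by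
        ext x
        have hf := f.contMDiff.mdifferentiableAt (x := x) (by simp)
        exact congrArg (fun T : TangentSpace 𝓘(ℝ, E) x →L[ℝ] ℝ => T (𝒜.anchor x (X x)))
          (const_smul_mfderiv hf c) }
    (fun f g => by
      ext x
      have hf := f.contMDiff.mdifferentiableAt (x := x) (by simp)
      have hg := g.contMDiff.mdifferentiableAt (x := x) (by simp)
      exact congrArg (fun T : TangentSpace 𝓘(ℝ, E) x →L[ℝ] ℝ => T (𝒜.anchor x (X x)))
          (mvfderiv_mul hf hg))
  map_add' X Y := by
    ext f x
    change mvfderiv 𝓘(ℝ, E) f x (𝒜.anchor x (X x + Y x)) = _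
    rw [map_add]
    exact map_add (mvfderiv 𝓘(ℝ, E) f x) _ _
  map_smul' c X := by
    ext f x
    change mvfderiv 𝓘(ℝ, E) f x (𝒜.anchor x (c x • X x)) = _
    rw [map_smul]
    exact map_smul (mvfderiv 𝓘(ℝ, E) f x) _ _

/-- The bracket and anchor of a Lie algebroid, on the module of sections. -/
def toSkew (𝒜 : LieAlgebroid E F A) :
    SkewAlgebroid C^∞⟮𝓘(ℝ, E), M; ℝ⟯ Cₛ^∞⟮𝓘(ℝ, E); F, A⟯ where
  anchor := 𝒜.anchorDer
  bracket X Y := 𝒜.bracket X Y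
  bracket_add X Y Z := map_add _ Y Z
  bracket_skew X Y := by
    have h := 𝒜.bracket_self (X + Y)
    simp only [map_add, LinearMap.add_apply, 𝒜.bracket_self, zero_add, add_zero] at h
    exact eq_neg_of_add_eq_zero_left (by rw [← h])
  leibniz X f Y := by
    ext x
    exact 𝒜.leibniz X Y f x

end LieAlgebroid

section TensorFields

variable (E : Type*) [NormedAddCommGroup E] [NormedSpace ℝ E]
  {M : Type*} [TopologicalSpace M] [ChartedSpace E M]
  (F : Type*) [NormedAddCommGroup F] [NormedSpace ℝ F]
  (A : M → Type*) [∀ x, AddCommGroup (A x)] [∀ x, Module ℝ (A x)] [∀ x, TopologicalSpace (A x)]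
  [TopologicalSpace (Bundle.TotalSpace F A)] [FiberBundle F A] [VectorBundle ℝ F A]

/-- `Γ(⋀ᵏ A*)`: alternating `C^∞(M)`-multilinear maps `Γ(A)ᵏ → C^∞(M)`. -/
abbrev AlgebroidForm (k : ℕ) : Type _ :=
  Cₛ^∞⟮𝓘(ℝ, E); F, A⟯ [⋀^Fin k]→ₗ[C^∞⟮𝓘(ℝ, E), M; ℝ⟯] C^∞⟮𝓘(ℝ, E), M; ℝ⟯

/-- `Γ(⋀² A)`: alternating `C^∞(M)`-bilinear maps `Γ(A*) × Γ(A*) → C^∞(M)`, where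
`Γ(A*) = Hom(Γ(A), C^∞(M))`. -/
abbrev AlgebroidBivector : Type _ :=
  Module.Dual C^∞⟮𝓘(ℝ, E), M; ℝ⟯ Cₛ^∞⟮𝓘(ℝ, E); F, A⟯
    [⋀^Fin 2]→ₗ[C^∞⟮𝓘(ℝ, E), M; ℝ⟯] C^∞⟮𝓘(ℝ, E), M; ℝ⟯

end TensorFields

end

/-! Both `π` and `Ω` are skew, so the two signs cancel in transposing `N = π♯ ∘ Ω♭`: the transpose
is `Ω♭ ∘ π♯` and `N` is self-adjoint for `Ω`. This already gives `N ∘ π♯ = π♯ ∘ ᵗN`.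

The central identity is `formBracket_flat`: for closed `Ω`, `Ω♭` carries `[x, y]_N` to `[Ω♭x,
Ω♭y]_π` up to the error `i_{x ∧ y} ψ`. Since `π♯` is a morphism of brackets for Poisson `π`,
applying it turns this error into the torsion of `N`. The concomitant, evaluated on a section, is a
combination of one value of `[π, π]` and one of `dΩ`.

Closedness of `ψ` is `d² = 0`. For `d_N ψ`, write `d_N = i_N d - d i_N`; the torsion formula paired
with `Ω` shows that `i_N ψ` is exact, with primitive `Ω(N·, N·)` (`dTwo_compLinearMap_recursion`),
so both terms vanish. The Jacobi identity enters only here, through `d² = 0`; compatibility of the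
anchor with brackets is deduced from it. -/

section Tensors

/-! ### Multilinear algebra of `π`, `Ω` and `N`. -/

variable {R L : Type*} [CommRing R] [AddCommGroup L] [Module R L]

theorem alt_add_left (B : L [⋀^Fin 2]→ₗ[R] R) (x x' y : L) :
    B ![x + x', y] = B ![x, y] + B ![x', y] := by
  simp only [← flat_apply, map_add, LinearMap.add_apply]

theorem alt_sub_left (B : L [⋀^Fin 2]→ₗ[R] R) (x x' y : L) :
    B ![x - x', y] = B ![x, y] - B ![x', y] := by
  simp only [← flat_apply, map_sub, LinearMap.sub_apply]

theorem alt_neg_left (B : L [⋀^Fin 2]→ₗ[R] R) (x y : L) : B ![-x, y] = -B ![x, y] := by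
  simp only [← flat_apply, map_neg, LinearMap.neg_apply]

theorem alt3_add_left (ψ : L [⋀^Fin 3]→ₗ[R] R) (x x' y z : L) :
    ψ ![x + x', y, z] = ψ ![x, y, z] + ψ ![x', y, z] :=
  ψ.map_vecCons_add ![y, z] x x'

theorem alt3_swap_left (ψ : L [⋀^Fin 3]→ₗ[R] R) (x y z : L) : ψ ![y, x, z] = -ψ ![x, y, z] := by
  rw [← ψ.map_swap ![x, y, z] (i := 0) (j := 1) (by decide)]
  congr 1
  funext i; fin_cases i <;> rfl

theorem alt3_swap_right (ψ : L [⋀^Fin 3]→ₗ[R] R) (x y z : L) : ψ ![x, z, y] = -ψ ![x, y, z] := by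
  rw [← ψ.map_swap ![x, y, z] (i := 1) (j := 2) (by decide)]
  congr 1
  funext i; fin_cases i <;> rfl

theorem alt3_sub_left (ψ : L [⋀^Fin 3]→ₗ[R] R) (x x' y z : L) :
    ψ ![x - x', y, z] = ψ ![x, y, z] - ψ ![x', y, z] := by
  rw [eq_sub_iff_add_eq, ← alt3_add_left, sub_add_cancel]

variable [Module.IsReflexive R L]
variable (π : Module.Dual R L [⋀^Fin 2]→ₗ[R] R) (Ω : L [⋀^Fin 2]→ₗ[R] R)

/-- Skewness is used once for `π` and once for `Ω`, so no sign remains. All symmetry properties of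
`N` come from this formula. -/
theorem apply_recursion (α : Module.Dual R L) (x : L) :
    α (recursion π Ω x) = Ω ![sharp π α, x] := by
  rw [recursion, LinearMap.comp_apply, apply_sharp, alt_swap, ← apply_sharp, flat_apply,
    ← alt_swap]

theorem apply_sharp_swap (α β : Module.Dual R L) : β (sharp π α) = -α (sharp π β) := by
  rw [apply_sharp, apply_sharp, alt_swap]

theorem sharp_flat (x : L) : sharp π (flat Ω x) = recursion π Ω x := rfl

theorem transp_recursion (α : Module.Dual R L) :
    transp (recursion π Ω) α = flat Ω (sharp π α) := by
  ext1 x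
  exact apply_recursion π Ω α x

/-- Self-adjointness of `N` for `Ω`; it lets every `N` be moved into the first slot, a normal form
in which identities can be checked by linear arithmetic. -/
theorem alt_recursion_right (x y : L) :
    Ω ![x, recursion π Ω y] = Ω ![recursion π Ω x, y] := by
  rw [← flat_apply, apply_recursion]
  rfl

/-- Both sides are `π♯ ∘ Ω♭ ∘ π♯`. -/
theorem recursion_comp_sharp :
    recursion π Ω ∘ₗ sharp π = sharp π ∘ₗ transp (recursion π Ω) := by
  ext1 α
  rw [LinearMap.comp_apply, LinearMap.comp_apply, transp_recursion]
  rfl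

end Tensors

/-! ### The differentials `d` and `d_N`, and the anchor of a Jacobi bracket. -/

namespace SkewAlgebroid

variable {R L : Type*} [CommRing R] [Algebra ℝ R] [AddCommGroup L] [Module R L]
variable (S : SkewAlgebroid R L)

theorem dTwo_apply (Ω : L [⋀^Fin 2]→ₗ[R] R) (x y z : L) :
    S.dTwo Ω ![x, y, z] =
      S.anchor x (Ω ![y, z]) - S.anchor y (Ω ![x, z]) + S.anchor z (Ω ![x, y])
        - Ω ![S.bracket x y, z] + Ω ![S.bracket x z, y] - Ω ![S.bracket y z, x] := rfl

/-- `d ∘ d = 0` on `2`-forms, given the Jacobi identity and that the anchor preserves brackets on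
the values of `1`-forms. -/
theorem dThree_dTwo
    (jac : ∀ x y z, S.bracket (S.bracket x y) z + S.bracket (S.bracket y z) x
      + S.bracket (S.bracket z x) y = 0)
    (hom : ∀ x y z (α : Module.Dual R L), S.anchor (S.bracket x y) (α z) =
      S.anchor x (S.anchor y (α z)) - S.anchor y (S.anchor x (α z)))
    (Ω : L [⋀^Fin 2]→ₗ[R] R) (x y z w : L) : S.dThree (S.dTwo Ω) x y z w = 0 := by
  have J : ∀ x y z w, Ω ![S.bracket (S.bracket x y) z, w] + Ω ![S.bracket (S.bracket y z) x, w]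
      - Ω ![S.bracket (S.bracket x z) y, w] = 0 := fun x y z w => by
    have h := congrArg (fun t => flat Ω t w) (jac x y z)
    rw [S.bracket_skew x z, S.neg_bracket] at h
    simpa [sub_eq_add_neg, alt_add_left, alt_neg_left] using h
  -- Values of `Ω` are values of the `1`-forms `Ω♭ z`, so the restricted form of `hom` is enough.
  have H : ∀ x y z w, S.anchor (S.bracket x y) (Ω ![z, w]) =
      S.anchor x (S.anchor y (Ω ![z, w])) - S.anchor y (S.anchor x (Ω ![z, w])) :=
    fun x y z w => hom x y w (flat Ω z)
  simp only [dThree, dTwo_apply, map_add, map_sub, H]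
  -- Terms with a bracket in both slots occur in pairs that cancel by skewness; what remains is one
  -- Jacobi identity for each argument left outside the brackets.
  rw [alt_swap Ω (S.bracket x y) (S.bracket z w), alt_swap Ω (S.bracket x z) (S.bracket y w),
    alt_swap Ω (S.bracket x w) (S.bracket y z)]
  linear_combination J x y z w - J x y w z + J x z w y - J y z w x

/-- `d_N = i_N d - d i_N` on `3`-forms. -/
theorem dThree_deform (N : Module.End R L) (ψ χ : L [⋀^Fin 3]→ₗ[R] R)
    (h : ∀ x y z, χ ![x, y, z] = ψ ![N x, y, z] + ψ ![x, N y, z] + ψ ![x, y, N z]) (x y z w : L) :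
    (S.deform N).dThree ψ x y z w =
      S.dThree ψ (N x) y z w + S.dThree ψ x (N y) z w + S.dThree ψ x y (N z) w
        + S.dThree ψ x y z (N w) - S.dThree χ x y z w := by
  simp only [dThree, deform, LinearMap.comp_apply, h, map_add, alt3_add_left, alt3_sub_left]
  ring

theorem dFun_apply (f : R) (x : L) : S.dFun f x = S.anchor x f := rfl

theorem lieForm_apply (x : L) (β : Module.Dual R L) (y : L) :
    S.lieForm x β y = S.anchor x (β y) - β (S.bracket x y) := rfl

theorem deform_anchor (N : Module.End R L) (x : L) : (S.deform N).anchor x = S.anchor (N x) := rfl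

theorem deform_bracket (N : Module.End R L) (x y : L) : (S.deform N).bracket x y =
    S.bracket (N x) y + S.bracket x (N y) - N (S.bracket x y) := rfl

/-- The anchor of a bracket satisfying the Jacobi identity preserves brackets, up to functions which
annihilate `L`. -/
theorem anchor_defect_smul
    (jac : ∀ x y z, S.bracket (S.bracket x y) z + S.bracket (S.bracket y z) x
      + S.bracket (S.bracket z x) y = 0) (x y z : L) (f : R) :
    (⁅S.anchor x, S.anchor y⁆ - S.anchor (S.bracket x y)) f • z = 0 := by
  have jac' : ∀ z, S.bracket (S.bracket x y) z = S.bracket x (S.bracket y z)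
      - S.bracket y (S.bracket x z) := fun z => by
    have h := jac x y z
    rw [S.bracket_skew x (S.bracket y z), S.bracket_skew x z, S.neg_bracket,
      S.bracket_skew y (S.bracket x z), neg_neg] at h
    rw [← sub_eq_zero, ← h]
    abel
  -- Comparing Jacobi at `f • z` with `f` times Jacobi at `z` leaves only the second-order anchor
  -- terms, which form the defect applied to `f`.
  have h := jac' (f • z)
  simp only [S.leibniz, S.bracket_add, jac' z] at h
  rw [← sub_eq_zero] at h
  rw [← neg_eq_zero, ← h, Derivation.sub_apply, Derivation.commutator_apply]
  module

/-- Over a reduced ring, the anchor of a bracket satisfying the Jacobi identity preserves brackets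
on the values of `1`-forms. -/
theorem anchor_bracket_apply [IsReduced R]
    (jac : ∀ x y z, S.bracket (S.bracket x y) z + S.bracket (S.bracket y z) x
      + S.bracket (S.bracket z x) y = 0) (x y z : L) (α : Module.Dual R L) :
    S.anchor (S.bracket x y) (α z) =
      S.anchor x (S.anchor y (α z)) - S.anchor y (S.anchor x (α z)) := by
  set D := ⁅S.anchor x, S.anchor y⁆ - S.anchor (S.bracket x y) with hD
  have h : ∀ f, D f * α z = 0 := fun f => by
    have h := congrArg α (S.anchor_defect_smul jac x y z f)
    rwa [map_smul, map_zero, smul_eq_mul] at h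
  -- Apply the derivation `D` to `D (α z) * α z = 0`: the term `D (D (α z)) * α z` vanishes by `h`
  -- again, leaving the square. No nowhere vanishing section is needed.
  have hsq : D (α z) ^ 2 = 0 := by
    have h₁ := congrArg D (h (α z))
    rw [D.leibniz, map_zero, smul_eq_mul, smul_eq_mul, mul_comm (α z), h, add_zero] at h₁
    rw [sq, h₁]
  have h₀ := pow_eq_zero_iff (two_ne_zero) |>.1 hsq
  rw [hD, Derivation.sub_apply, Derivation.commutator_apply] at h₀
  exact (sub_eq_zero.1 h₀).symm

/-! ### Poisson bivectors combined with a closed `2`-form. -/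

variable [Module.IsReflexive R L]
variable {S} {π : Module.Dual R L [⋀^Fin 2]→ₗ[R] R} {Ω : L [⋀^Fin 2]→ₗ[R] R}

/-- `schouten π π` counts each term of the cyclic sum twice, and `2` is invertible over `ℝ`. -/
theorem IsPoisson.cyclic (hπ : S.IsPoisson π) (α β γ : Module.Dual R L) :
    α (S.bracket (sharp π β) (sharp π γ)) + β (S.bracket (sharp π γ) (sharp π α))
      + γ (S.bracket (sharp π α) (sharp π β)) - S.anchor (sharp π α) (π ![β, γ])
      - S.anchor (sharp π β) (π ![γ, α]) - S.anchor (sharp π γ) (π ![α, β]) = 0 := by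
  have h := hπ α β γ
  rw [schouten] at h
  set t := α (S.bracket (sharp π β) (sharp π γ)) + β (S.bracket (sharp π γ) (sharp π α))
      + γ (S.bracket (sharp π α) (sharp π β)) - S.anchor (sharp π α) (π ![β, γ])
      - S.anchor (sharp π β) (π ![γ, α]) - S.anchor (sharp π γ) (π ![α, β]) with ht
  have h2 : (2 : ℝ) • t = 0 := by rw [two_smul, ht]; linear_combination h
  exact (smul_eq_zero_iff_right (two_ne_zero (α := ℝ))).1 h2

/-- For a Poisson bivector, `π♯` maps the bracket of `1`-forms to the bracket of sections. -/
theorem IsPoisson.sharp_formBracket (hπ : S.IsPoisson π) (α β : Module.Dual R L) :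
    sharp π (S.formBracket π α β) = S.bracket (sharp π α) (sharp π β) := by
  apply (Module.evalEquiv R L).injective
  ext1 γ
  have h := hπ.cyclic α β γ
  rw [S.bracket_skew (sharp π α) (sharp π γ), map_neg, alt_swap π α γ, map_neg] at h
  simp only [Module.evalEquiv_apply, Module.Dual.eval_apply]
  -- Skewness of `π♯` moves it onto `γ`; expanding the Lie derivatives at `π♯ γ` then gives exactly
  -- the cyclic identity.
  rw [apply_sharp_swap, formBracket]
  simp only [LinearMap.sub_apply, lieForm_apply, dFun_apply]
  rw [apply_sharp, apply_sharp, alt_swap π β γ, alt_swap π α γ, map_neg, map_neg]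
  linear_combination -h

/-- At `z`, the concomitant is twice the cyclic Poisson sum for `α`, `β`, `Ω♭ z` minus twice
`dΩ(π♯α, π♯β, z)`. -/
theorem concomitant_recursion (hπ : S.IsPoisson π) (hΩ : S.dTwo Ω = 0) (α β : Module.Dual R L) :
    S.concomitant π (recursion π Ω) α β = 0 := by
  ext1 z
  have h := hπ.cyclic α β (flat Ω z)
  have hd : S.dTwo Ω ![sharp π α, sharp π β, z] = 0 := by rw [hΩ]; rfl
  have hs : ∀ α, sharp π (transp (recursion π Ω) α) = recursion π Ω (sharp π α) := fun α =>
    (LinearMap.congr_fun (recursion_comp_sharp π Ω) α).symm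
  have ht : π ![transp (recursion π Ω) α, β] = -Ω ![sharp π α, sharp π β] := by
    rw [← apply_sharp, hs, apply_recursion, alt_swap]
  have ht' : π ![α, transp (recursion π Ω) β] = -Ω ![sharp π α, sharp π β] := by
    rw [alt_swap, ← apply_sharp, hs, apply_recursion]
  have hf : ∀ α, π ![α, flat Ω z] = -Ω ![sharp π α, z] := fun α => by
    rw [← apply_sharp, flat_apply, alt_swap]
  rw [alt_swap π α (flat Ω z), map_neg, sharp_flat, hf, hf, flat_apply,
    alt_swap Ω (S.bracket (sharp π α) (sharp π β)) z,
    S.bracket_skew (sharp π α) (recursion π Ω z), map_neg] at h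
  rw [dTwo_apply] at hd
  simp only [concomitant, formBracket, deform_anchor, deform_bracket, LinearMap.sub_apply,
    LinearMap.add_apply, lieForm_apply, dFun_apply, transp_apply, hs, ht, ht',
    map_add, map_sub, LinearMap.zero_apply, map_neg] at h ⊢
  simp only [apply_recursion]
  rw [alt_swap Ω (S.bracket (sharp π α) z) (sharp π β),
    alt_swap Ω (S.bracket (sharp π β) z) (sharp π α)]
  linear_combination 2 * h - 2 * hd

/-- At `z`, the difference of the two sides is `dΩ(Nx, y, z) + dΩ(x, Ny, z)`. Only closedness of `Ω`
matters; `π` may be any bivector. -/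
theorem formBracket_flat (hΩ : S.dTwo Ω = 0) (x y : L) :
    S.formBracket π (flat Ω x) (flat Ω y) =
      flat Ω (S.bracket (recursion π Ω x) y + S.bracket x (recursion π Ω y)
        - recursion π Ω (S.bracket x y)) + contract₂ (S.dTwo (omegaN π Ω)) x y := by
  ext1 z
  have h₁ : S.dTwo Ω ![recursion π Ω x, y, z] = 0 := by rw [hΩ]; rfl
  have h₂ : S.dTwo Ω ![x, recursion π Ω y, z] = 0 := by rw [hΩ]; rfl
  have e : π ![flat Ω x, flat Ω y] = -Ω ![recursion π Ω x, y] := by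
    rw [← apply_sharp, sharp_flat, flat_apply, alt_swap]
  rw [dTwo_apply, alt_recursion_right] at h₁ h₂
  rw [alt_recursion_right] at h₂
  simp only [formBracket, LinearMap.sub_apply, LinearMap.add_apply, lieForm_apply, dFun_apply,
    sharp_flat, e, map_add, map_sub, map_neg, contract₂_apply, dTwo_apply, omegaN_apply,
    flat_apply]
  rw [alt_swap Ω (S.bracket (recursion π Ω x) z) y, alt_swap Ω (S.bracket (recursion π Ω y) z) x,
    S.bracket_skew x y, ← alt_recursion_right π Ω y x, alt_swap Ω (recursion π Ω x) y]
  simp only [map_neg, alt_neg_left]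
  linear_combination h₁ + h₂

/-- Apply `π♯` to `formBracket_flat`: the left side becomes `[Nx, Ny]` because `π` is Poisson, and
`π♯ ∘ Ω♭ = N` turns the first term on the right into `N [x, y]_N`. -/
theorem torsion_recursion (hπ : S.IsPoisson π) (hΩ : S.dTwo Ω = 0) (x y : L) :
    S.torsion (recursion π Ω) x y = sharp π (contract₂ (S.dTwo (omegaN π Ω)) x y) := by
  have h := congrArg (sharp π) (formBracket_flat (π := π) hΩ x y)
  rw [hπ.sharp_formBracket, map_add] at h
  rw [torsion, sub_eq_iff_eq_add']
  exact h

/-- The right side is `i_N ψ`; its exactness is what makes `ψ` closed for `d_N`. -/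
theorem dTwo_compLinearMap_recursion (hπ : S.IsPoisson π) (hΩ : S.dTwo Ω = 0) (x y z : L) :
    S.dTwo (Ω.compLinearMap (recursion π Ω)) ![x, y, z] =
      S.dTwo (omegaN π Ω) ![recursion π Ω x, y, z] + S.dTwo (omegaN π Ω) ![x, recursion π Ω y, z]
        + S.dTwo (omegaN π Ω) ![x, y, recursion π Ω z] := by
  set N := recursion π Ω with hN
  -- The torsion formula paired with `Ω(·, z)`: since `Ω(π♯β, z) = β(Nz)`, it expresses `ψ` with an
  -- `N` in its last slot through brackets alone, without anchor terms.
  have hT : ∀ x y z, S.dTwo (omegaN π Ω) ![x, y, N z] =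
      -Ω ![S.bracket (N x) (N y), z] + Ω ![N (S.bracket (N x) y), z]
        + Ω ![N (S.bracket x (N y)), z] - Ω ![N (S.bracket x y), N z] := fun x y z => by
    have h := congrArg (fun t => Ω ![t, z]) (torsion_recursion hπ hΩ x y)
    simp only [← apply_recursion, contract₂_apply] at h
    rw [alt3_swap_left, ← hN, torsion] at h
    simp only [map_add, map_sub, alt_add_left, alt_sub_left] at h
    rw [hN, alt_recursion_right, ← hN]
    linear_combination h
  have hc' : ∀ x y, Ω ![N x, N y] = Ω ![N (N x), y] := fun x y => alt_recursion_right π Ω _ _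
  have hc : ∀ x y, Ω.compLinearMap N ![x, y] = Ω ![N (N x), y] := fun x y => by
    rw [← hc', AlternatingMap.compLinearMap_apply]
    congr 1
    funext i; fin_cases i <;> rfl
  -- Antisymmetry brings the argument with `N` to the last slot, where `hT` applies.
  have hx : S.dTwo (omegaN π Ω) ![N x, y, z] = S.dTwo (omegaN π Ω) ![y, z, N x] := by
    rw [alt3_swap_left, alt3_swap_right, neg_neg]
  have hy : S.dTwo (omegaN π Ω) ![x, N y, z] = -S.dTwo (omegaN π Ω) ![x, z, N y] := by
    rw [alt3_swap_right]
  have tx := hx.trans (hT y z x)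
  have ty := hy.trans (congrArg Neg.neg (hT x z y))
  have tz := hT x y z
  have h₁ : S.dTwo Ω ![N x, N y, z] = 0 := by rw [hΩ]; rfl
  have h₂ : S.dTwo Ω ![N x, y, N z] = 0 := by rw [hΩ]; rfl
  have h₃ : S.dTwo Ω ![x, N y, N z] = 0 := by rw [hΩ]; rfl
  have right : ∀ x y, Ω ![x, N y] = Ω ![N x, y] := alt_recursion_right π Ω
  have om : ∀ x y, omegaN π Ω ![x, y] = Ω ![N x, y] := fun _ _ => rfl
  simp only [dTwo_apply, om, hc, right] at h₁ h₂ h₃ tx ty tz ⊢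
  -- The anchor terms of the difference are, up to sign, one cyclic sum of `ρ(Nx) Ω(Ny, z)` and one
  -- of `ρ(x) Ω(N²y, z)`. The three closedness relations together contain these with weights `2, 1`,
  -- the three expansions of `ψ` with weights `1, 2`. A symmetric combination therefore needs the
  -- coefficient `1/3` throughout, cleared by multiplying by `3`.
  refine sub_eq_zero.1 ((smul_eq_zero_iff_right (three_ne_zero (α := ℝ))).1 ?_)
  rw [show (3 : ℝ) = 1 + 1 + 1 by norm_num, add_smul, add_smul, one_smul]
  linear_combination -h₁ - h₂ - h₃ - tx - ty - tz

/-- A Poisson bivector and a closed `2`-form define a Poisson quasi-Nijenhuis structure, for a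
bracket which satisfies the Jacobi identity and whose anchor preserves brackets on the values of
`1`-forms. -/
theorem isPoissonQuasiNijenhuis_recursion
    (jac : ∀ x y z, S.bracket (S.bracket x y) z + S.bracket (S.bracket y z) x
      + S.bracket (S.bracket z x) y = 0)
    (hom : ∀ x y z (α : Module.Dual R L), S.anchor (S.bracket x y) (α z) =
      S.anchor x (S.anchor y (α z)) - S.anchor y (S.anchor x (α z)))
    (hπ : S.IsPoisson π) (hΩ : S.dTwo Ω = 0) :
    S.IsPoissonQuasiNijenhuis π (recursion π Ω) (S.dTwo (omegaN π Ω)) where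
  poisson := hπ
  comm := recursion_comp_sharp π Ω
  concomitant_eq_zero := concomitant_recursion hπ hΩ
  torsion_eq := torsion_recursion hπ hΩ
  closed := S.dThree_dTwo jac hom _
  closed_deform x y z w := by
    -- Here `i_N ψ` is represented by `d(Ω(N·, N·))`, so every term that appears is a value of `d²`.
    rw [S.dThree_deform _ _ _ (dTwo_compLinearMap_recursion hπ hΩ)]
    simp only [S.dThree_dTwo jac hom, add_zero, sub_zero]

end SkewAlgebroid

/-! ### The case of sections of a Lie algebroid. -/

theorem mainTheorem9
    {E : Type*} [NormedAddCommGroup E] [NormedSpace ℝ E] [FiniteDimensional ℝ E]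
    {M : Type*} [TopologicalSpace M] [T2Space M] [ChartedSpace E M] [IsManifold 𝓘(ℝ, E) ∞ M]
    {F : Type*} [NormedAddCommGroup F] [NormedSpace ℝ F] [FiniteDimensional ℝ F]
    {A : M → Type*} [∀ x, AddCommGroup (A x)] [∀ x, Module ℝ (A x)] [∀ x, TopologicalSpace (A x)]
    [TopologicalSpace (Bundle.TotalSpace F A)] [FiberBundle F A] [VectorBundle ℝ F A]
    [ContMDiffVectorBundle ∞ F A 𝓘(ℝ, E)]
    (𝒜 : LieAlgebroid E F A)
    (π : AlgebroidBivector E F A) (hπ : 𝒜.toSkew.IsPoisson π)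
    (Ω : AlgebroidForm E F A 2) (hΩ : 𝒜.toSkew.dTwo Ω = 0) :
    𝒜.toSkew.IsPoissonQuasiNijenhuis π (recursion π Ω) (𝒜.toSkew.dTwo (omegaN π Ω)) := by
  -- Nilpotents vanish pointwise because the values are real; this is what lets
  -- `anchor_bracket_apply` derive anchor compatibility from Jacobi.
  have : IsReduced C^∞⟮𝓘(ℝ, E), M; ℝ⟯ := ⟨fun f ⟨n, hn⟩ => by
    ext x
    have h : (f ^ n) x = 0 := by rw [hn]; rfl
    exact eq_zero_of_pow_eq_zero (n := n) (by rw [← h]; simp)⟩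
  have jac : ∀ X Y Z, 𝒜.toSkew.bracket (𝒜.toSkew.bracket X Y) Z
      + 𝒜.toSkew.bracket (𝒜.toSkew.bracket Y Z) X
      + 𝒜.toSkew.bracket (𝒜.toSkew.bracket Z X) Y = 0 := fun X Y Z => by
    rw [𝒜.toSkew.bracket_skew Z (𝒜.toSkew.bracket X Y),
      𝒜.toSkew.bracket_skew X (𝒜.toSkew.bracket Y Z),
      𝒜.toSkew.bracket_skew Y (𝒜.toSkew.bracket Z X), ← neg_add, ← neg_add, neg_eq_zero,
      ← 𝒜.jacobi X Y Z]
    change 𝒜.bracket Z (𝒜.bracket X Y) + 𝒜.bracket X (𝒜.bracket Y Z)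
      + 𝒜.bracket Y (𝒜.bracket Z X) = _
    abel
  exact SkewAlgebroid.isPoissonQuasiNijenhuis_recursion jac
    (𝒜.toSkew.anchor_bracket_apply jac) hπ hΩ
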